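/- Let $M$ be a smooth manifold of dimension $n$ and $\alpha$ a smooth 1-form on $M$. The genre of $\alpha$ at a point $x\in M$ is the highest degree of a form in the sequence $$\alpha,\ d\alpha,\ \alpha\wedge d\alpha,\ (d\alpha)^2,\ \alpha\wedge (d\alpha)^2,\ \dots$$ that is nonzero at $x$ (and $0$ if all of them vanish at $x$). The pair $(M,\alpha)$ is called nondegenerate if the genre of $\alpha$ equals $\dim M$ at every point of $M$. Suppose that $(M,\alpha)$ is nondegenerate. Let $\mathbb R^*=\mathbb R\setminus\{0\}$ with coordinate $t$, let $M_+=M\times\mathbb R^*$, and let $\alpha_+=t\alpha+dt$, where $\alpha$ is pulled back to $M_+$ along the projection $M_+\to M$. Then $\alpha_+$ is a smooth 1-form on the $(n+1)$-dimensional manifold $M_+$ and the pair $(M_+,\alpha_+)$ is nondegenerate. Moreover, if $n=2k$ is even, then $\alpha_+$ is a contact form, i.e. $\alpha_+\wedge(d\alpha_+)^k$ vanishes nowhere on $M_+$; if $n$ is odd, then $d\alpha_+$ is a symplectic form on $M_+$, i.e. a smooth closed 2-form that is nondegenerate on every tangent space. -/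

import Mathlib

open scoped Manifold ContDiff

noncomputable section

/-- The exterior product of two alternating forms on a real vector space, by the shuffle formula:
`(a ∧ b)(v₁, …, v_{k+l})` is the sum over `(k, l)`-shuffles `σ` of
`sign σ * a (v_{σ 1}, …, v_{σ k}) * b (v_{σ (k+1)}, …, v_{σ (k+l)})`. -/
def wedge {V : Type*} [AddCommGroup V] [Module ℝ V] {k l : ℕ}
    (a : V [⋀^Fin k]→ₗ[ℝ] ℝ) (b : V [⋀^Fin l]→ₗ[ℝ] ℝ) : V [⋀^Fin (k + l)]→ₗ[ℝ] ℝ :=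
  ((LinearMap.mul' ℝ ℝ).compAlternatingMap (a.domCoprod b)).domDomCongr finSumFinEquiv

/-- The `j`-th exterior power `η ∧ ⋯ ∧ η` of an alternating 2-form; it is `1` for `j = 0`. -/
def wedgePow {V : Type*} [AddCommGroup V] [Module ℝ V] (η : V [⋀^Fin 2]→ₗ[ℝ] ℝ) :
    (j : ℕ) → V [⋀^Fin (2 * j)]→ₗ[ℝ] ℝ
  | 0 => AlternatingMap.constOfIsEmpty ℝ V (Fin 0) 1
  | j + 1 => wedge (wedgePow η j) η

section Forms

variable {E : Type*} [NormedAddCommGroup E] [NormedSpace ℝ E]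
  {H : Type*} [TopologicalSpace H]
  {E' : Type*} [NormedAddCommGroup E'] [NormedSpace ℝ E']
  {H' : Type*} [TopologicalSpace H']

/-- A (not necessarily smooth) real differential form of degree `k` on the manifold `M`. -/
abbrev DiffForm (I : ModelWithCorners ℝ E H) (M : Type*) [TopologicalSpace M]
    [ChartedSpace H M] (k : ℕ) : Type _ :=
  (x : M) → TangentSpace I x [⋀^Fin k]→L[ℝ] ℝ

variable (I : ModelWithCorners ℝ E H) (I' : ModelWithCorners ℝ E' H')
  {M : Type*} [TopologicalSpace M] [ChartedSpace H M]
  {M' : Type*} [TopologicalSpace M'] [ChartedSpace H' M']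

/-- The pullback `f^* η` of a differential form under a map `f : M → M'`. -/
def pullbackForm {k : ℕ} (f : M → M') (η : DiffForm I' M' k) : DiffForm I M k :=
  fun x => (η (f x)).compContinuousLinearMap (mfderiv I I' f x)

/-- The differential 1-form `df` of a real function `f` on `M`. -/
def differential (f : M → ℝ) : DiffForm I M 1 :=
  fun x => ContinuousAlternatingMap.ofSubsingleton ℝ (TangentSpace I x) ℝ (0 : Fin 1)
    (mfderiv I 𝓘(ℝ, ℝ) f x)

/-- The coordinate expression of a differential form in the chart at `x₀`: its pullback, under the
inverse of that chart, to the model vector space. -/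
def chartRep {k : ℕ} (η : DiffForm I M k) (x₀ : M) : E → E [⋀^Fin k]→L[ℝ] ℝ :=
  fun y => (η ((extChartAt I x₀).symm y)).compContinuousLinearMap
    (mfderivWithin 𝓘(ℝ, E) I (extChartAt I x₀).symm (Set.range I) y)

/-- A differential form is smooth when all its coordinate expressions are `C^∞`. -/
def IsSmoothForm {k : ℕ} (η : DiffForm I M k) : Prop :=
  ∀ x₀ : M, ContDiffOn ℝ ∞ (chartRep I η x₀) (extChartAt I x₀).target

/-- The exterior derivative of a differential form on a manifold: at `x`, it is the exterior
derivative of the coordinate expression in the chart at `x`, pulled back by that chart. -/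
def extD {k : ℕ} (η : DiffForm I M k) : DiffForm I M (k + 1) :=
  fun x =>
    (extDerivWithin (chartRep I η x) (Set.range I) (extChartAt I x x)).compContinuousLinearMap
      (mfderiv I 𝓘(ℝ, E) (extChartAt I x) x : TangentSpace I x →L[ℝ] E)

/-- The value at `x` of the `2j`-form `(dα)^j`. -/
def evenTerm (α : DiffForm I M 1) (j : ℕ) (x : M) : TangentSpace I x [⋀^Fin (2 * j)]→ₗ[ℝ] ℝ :=
  wedgePow (extD I α x).toAlternatingMap j

/-- The value at `x` of the `(2j+1)`-form `α ∧ (dα)^j`. -/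
def oddTerm (α : DiffForm I M 1) (j : ℕ) (x : M) :
    TangentSpace I x [⋀^Fin (1 + 2 * j)]→ₗ[ℝ] ℝ :=
  wedge (α x).toAlternatingMap (evenTerm I α j x)

/-- The genre of a 1-form `α` at `x`: the highest degree of a form of the sequence
`α, dα, α ∧ dα, (dα)^2, α ∧ (dα)^2, …` that is nonzero at `x` (and `0` if there is none). -/
def genreAt (α : DiffForm I M 1) (x : M) : ℕ :=
  sSup {m : ℕ | (∃ j, m = 1 + 2 * j ∧ oddTerm I α j x ≠ 0) ∨
    (∃ j, 1 ≤ j ∧ m = 2 * j ∧ evenTerm I α j x ≠ 0)}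

/-- The pair `(M, α)` is nondegenerate: the genre of `α` equals `dim M` (at every point). -/
def IsNondegeneratePair (α : DiffForm I M 1) : Prop :=
  ∀ x : M, genreAt I α x = Module.finrank ℝ E

/-- `α` is a contact form: it is smooth, `dim M = 2k + 1`, and `α ∧ (dα)^k` is nowhere zero. -/
def IsContactForm (α : DiffForm I M 1) : Prop :=
  IsSmoothForm I α ∧ ∃ k, Module.finrank ℝ E = 2 * k + 1 ∧ ∀ x : M, oddTerm I α k x ≠ 0

/-- `η` is a symplectic form: a smooth, closed 2-form that is nondegenerate on every tangent
space. -/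
def IsSymplecticForm (η : DiffForm I M 2) : Prop :=
  IsSmoothForm I η ∧ (∀ x : M, extD I η x = 0) ∧
    ∀ (x : M) (v : TangentSpace I x), (∀ w : TangentSpace I x, η x ![v, w] = 0) → v = 0

/-- The suspension form `t α + dt` on `M × ℝ^*`, where `t` is the coordinate on
`ℝ^* = ℝ \ {0}` and `α` is pulled back along the projection to `M`. -/
def suspensionForm (α : DiffForm I M 1) : DiffForm (I.prod 𝓘(ℝ, ℝ)) (M × ℝˣ) 1 :=
  fun p => (p.2 : ℝ) • pullbackForm (I.prod 𝓘(ℝ, ℝ)) I (Prod.fst : M × ℝˣ → M) α p +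
    differential (I.prod 𝓘(ℝ, ℝ)) (fun q : M × ℝˣ => (q.2 : ℝ)) p

end Forms

end

open scoped Manifold ContDiff

noncomputable section

theorem sum_sign_mul_cons_comp_perm {V : Type*} [AddCommGroup V] [Module ℝ V] {n : ℕ}
    (F : (Fin (n + 1) → V) → ℝ) (x : V) (v : Fin n → V) :
    ∑ σ : Equiv.Perm (Fin (n + 1)), ((Equiv.Perm.sign σ : ℤ) : ℝ) *
        F ((Fin.cons x v : Fin (n + 1) → V) ∘ σ) =
      ∑ p : Fin (n + 1), ∑ τ : Equiv.Perm (Fin n),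
        (-1) ^ (p : ℕ) * ((Equiv.Perm.sign τ : ℤ) : ℝ) * F (p.insertNth x (v ∘ τ)) := by
  rw [← Fintype.sum_prod_type']
  symm
  let g : Fin (n + 1) × Equiv.Perm (Fin n) → Equiv.Perm (Fin (n + 1)) := fun q =>
    Equiv.Perm.decomposeFin.symm (0, q.2) * q.1.cycleRange
  have hg : Function.Bijective g := by
    rw [Fintype.bijective_iff_injective_and_card]
    refine ⟨?_, by simp [Fintype.card_perm, Nat.factorial_succ]⟩
    rintro ⟨p, τ⟩ ⟨p', τ'⟩ h
    have key : ∀ (p : Fin (n + 1)) (τ : Equiv.Perm (Fin n)), g (p, τ) p = 0 := by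
      intro p τ
      simp [g]
    have hp : p = p' := (g (p', τ')).injective (by rw [key, ← h, key])
    subst hp
    have := mul_right_cancel h
    simpa using this
  refine Fintype.sum_bijective g hg _ _ ?_
  rintro ⟨p, τ⟩
  have h1 : (Fin.cons x v : Fin (n + 1) → V) ∘ (g (p, τ)) = p.insertNth x (v ∘ τ) := by
    rw [← Fin.cons_comp_cycleRange]
    funext j
    simp only [g, Function.comp_apply, Equiv.Perm.mul_apply]
    generalize p.cycleRange j = i
    cases i using Fin.cases <;> simp
  rw [h1]
  simp [g, Fin.sign_cycleRange, mul_comm]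

section Wedge

variable {V : Type*} [AddCommGroup V] [Module ℝ V]

theorem factorial_mul_wedge_apply {k l : ℕ} (a : V [⋀^Fin k]→ₗ[ℝ] ℝ) (b : V [⋀^Fin l]→ₗ[ℝ] ℝ)
    (v : Fin (k + l) → V) :
    ((k.factorial * l.factorial : ℕ) : ℝ) * wedge a b v =
      ∑ σ : Equiv.Perm (Fin (k + l)), ((Equiv.Perm.sign σ : ℤ) : ℝ) *
        (a (fun i => v (σ (Fin.castAdd l i))) * b (fun i => v (σ (Fin.natAdd k i)))) := by
  have h := congrArg (fun f => LinearMap.mul' ℝ ℝ (f (v ∘ finSumFinEquiv)))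
    (MultilinearMap.domCoprod_alternization_eq a b)
  simp only [Fintype.card_fin, MultilinearMap.alternatization_apply, AlternatingMap.smul_apply,
    map_nsmul, map_sum] at h
  rw [← nsmul_eq_mul]
  refine h.symm.trans ?_
  refine Fintype.sum_equiv finSumFinEquiv.permCongr _ _ fun σ => ?_
  rw [Units.smul_def, map_zsmul, zsmul_eq_mul]
  simp [MultilinearMap.domCoprod_apply, Function.comp_def, Equiv.permCongr_apply]

theorem wedge_ext_factorial {k l : ℕ} {x y : ℝ}
    (h : ((k.factorial * l.factorial : ℕ) : ℝ) * x = ((k.factorial * l.factorial : ℕ) : ℝ) * y) :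
    x = y :=
  mul_left_cancel₀ (by positivity) h

@[simp]
theorem zero_wedge {k l : ℕ} (b : V [⋀^Fin l]→ₗ[ℝ] ℝ) :
    wedge (0 : V [⋀^Fin k]→ₗ[ℝ] ℝ) b = 0 := by
  ext v
  apply wedge_ext_factorial (k := k) (l := l)
  rw [factorial_mul_wedge_apply]
  simp

@[simp]
theorem wedge_zero {k l : ℕ} (a : V [⋀^Fin k]→ₗ[ℝ] ℝ) :
    wedge a (0 : V [⋀^Fin l]→ₗ[ℝ] ℝ) = 0 := by
  ext v
  apply wedge_ext_factorial (k := k) (l := l)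
  rw [factorial_mul_wedge_apply]
  simp

theorem smul_wedge_smul {k l : ℕ} (c d : ℝ) (a : V [⋀^Fin k]→ₗ[ℝ] ℝ) (b : V [⋀^Fin l]→ₗ[ℝ] ℝ) :
    wedge (c • a) (d • b) = (c * d) • wedge a b := by
  ext v
  apply wedge_ext_factorial (k := k) (l := l)
  rw [factorial_mul_wedge_apply, AlternatingMap.smul_apply, smul_eq_mul, mul_left_comm,
    factorial_mul_wedge_apply, Finset.mul_sum]
  refine Finset.sum_congr rfl fun σ _ => ?_
  simp only [AlternatingMap.smul_apply, smul_eq_mul]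
  ring

theorem wedge_compLinearMap {W : Type*} [AddCommGroup W] [Module ℝ W] {k l : ℕ}
    (a : V [⋀^Fin k]→ₗ[ℝ] ℝ) (b : V [⋀^Fin l]→ₗ[ℝ] ℝ) (L : W →ₗ[ℝ] V) :
    (wedge a b).compLinearMap L = wedge (a.compLinearMap L) (b.compLinearMap L) := by
  ext v
  apply wedge_ext_factorial (k := k) (l := l)
  rw [AlternatingMap.compLinearMap_apply, factorial_mul_wedge_apply, factorial_mul_wedge_apply]
  rfl

/-- Contraction with a vector is an antiderivation of the exterior product. -/
theorem wedge_cons {k l : ℕ} (a : V [⋀^Fin (k + 1)]→ₗ[ℝ] ℝ) (b : V [⋀^Fin (l + 1)]→ₗ[ℝ] ℝ)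
    (x : V) (v : Fin (k + 1 + l) → V) :
    wedge a b (Fin.cons x v : Fin (k + 1 + l + 1) → V) =
      wedge (a.curryLeft x) b (v ∘ Fin.cast (by omega)) +
        (-1) ^ (k + 1) * wedge a (b.curryLeft x) v := by
  apply wedge_ext_factorial (k := k + 1) (l := l + 1)
  rw [factorial_mul_wedge_apply]
  have h := sum_sign_mul_cons_comp_perm
    (fun u : Fin (k + 1 + l + 1) → V => a (fun i => u (Fin.castAdd (l + 1) i)) *
      b (fun i => u (Fin.natAdd (k + 1) i))) x v
  refine h.trans ?_
  have hsplit : ∀ G : Fin (k + 1 + l + 1) → ℝ, ∑ p, G p =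
      ∑ q : Fin (k + 1), G (Fin.castAdd (l + 1) q) + ∑ q : Fin (l + 1), G (Fin.natAdd (k + 1) q) :=
    fun G => Fin.sum_univ_add (a := k + 1) (b := l + 1) G
  rw [hsplit]
  have hkl : k + (l + 1) = k + 1 + l := by omega
  have hL : ∀ (q : Fin (k + 1)) (τ : Equiv.Perm (Fin (k + 1 + l))),
      (-1) ^ ((Fin.castAdd (l + 1) q : Fin (k + 1 + l + 1)) : ℕ) *
        ((Equiv.Perm.sign τ : ℤ) : ℝ) *
        (a (fun i => (Fin.castAdd (l + 1) q : Fin (k + 1 + l + 1)).insertNth (α := fun _ => V) x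
            (v ∘ τ) (Fin.castAdd (l + 1) i)) *
          b (fun i => (Fin.castAdd (l + 1) q : Fin (k + 1 + l + 1)).insertNth (α := fun _ => V) x
            (v ∘ τ) (Fin.natAdd (k + 1) i))) =
      ((Equiv.Perm.sign τ : ℤ) : ℝ) *
        (a.curryLeft x (fun i => v (τ (Fin.cast hkl (Fin.castAdd (l + 1) i)))) *
          b (fun i => v (τ (Fin.cast hkl (Fin.natAdd k i))))) := by
    intro q τ
    have ha : (fun i => (Fin.castAdd (l + 1) q : Fin (k + 1 + l + 1)).insertNth (α := fun _ => V) x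
        (v ∘ τ) (Fin.castAdd (l + 1) i)) =
        q.insertNth x (fun i => v (τ (Fin.cast hkl (Fin.castAdd (l + 1) i)))) := by
      funext i
      rcases Fin.eq_self_or_eq_succAbove q i with rfl | ⟨j, rfl⟩
      · simp
      · have : (Fin.castAdd (l + 1) (q.succAbove j) : Fin (k + 1 + l + 1)) =
            (Fin.castAdd (l + 1) q : Fin (k + 1 + l + 1)).succAbove
              (Fin.cast hkl (Fin.castAdd (l + 1) j)) := by
          ext
          simp only [Fin.succAbove, Fin.lt_def, Fin.val_castAdd, Fin.val_castSucc, Fin.val_cast]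
          split_ifs <;> simp
        rw [this, Fin.insertNth_apply_succAbove, Fin.insertNth_apply_succAbove]
        rfl
    have hb : (fun i => (Fin.castAdd (l + 1) q : Fin (k + 1 + l + 1)).insertNth (α := fun _ => V) x
        (v ∘ τ) (Fin.natAdd (k + 1) i)) =
        fun i => v (τ (Fin.cast hkl (Fin.natAdd k i))) := by
      funext i
      have : (Fin.natAdd (k + 1) i : Fin (k + 1 + l + 1)) =
          (Fin.castAdd (l + 1) q : Fin (k + 1 + l + 1)).succAbove
            (Fin.cast hkl (Fin.natAdd k i)) := by
        ext
        simp only [Fin.succAbove, Fin.lt_def, Fin.val_castAdd, Fin.val_castSucc, Fin.val_cast,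
          Fin.val_natAdd]
        split_ifs <;> simp <;> omega
      rw [this, Fin.insertNth_apply_succAbove]
      rfl
    rw [ha, hb, AlternatingMap.map_insertNth, zsmul_eq_mul, Fin.val_castAdd]
    have h1 : ((-1 : ℝ) ^ (q : ℕ)) * (-1) ^ (q : ℕ) = 1 := by rw [← mul_pow]; simp
    push_cast
    simp only [AlternatingMap.curryLeft_apply_apply]
    linear_combination (((Equiv.Perm.sign τ : ℤ) : ℝ) *
        (a (Matrix.vecCons x (fun i => v (τ (Fin.cast hkl (Fin.castAdd (l + 1) i))))) *
          b (fun i => v (τ (Fin.cast hkl (Fin.natAdd k i)))))) * h1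
  have hR : ∀ (q : Fin (l + 1)) (τ : Equiv.Perm (Fin (k + 1 + l))),
      (-1) ^ ((Fin.natAdd (k + 1) q : Fin (k + 1 + l + 1)) : ℕ) *
        ((Equiv.Perm.sign τ : ℤ) : ℝ) *
        (a (fun i => (Fin.natAdd (k + 1) q : Fin (k + 1 + l + 1)).insertNth (α := fun _ => V) x
            (v ∘ τ) (Fin.castAdd (l + 1) i)) *
          b (fun i => (Fin.natAdd (k + 1) q : Fin (k + 1 + l + 1)).insertNth (α := fun _ => V) x
            (v ∘ τ) (Fin.natAdd (k + 1) i))) =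
      (-1) ^ (k + 1) * (((Equiv.Perm.sign τ : ℤ) : ℝ) *
        (a (fun i => v (τ (Fin.castAdd l i))) *
          b.curryLeft x (fun i => v (τ (Fin.natAdd (k + 1) i))))) := by
    intro q τ
    have ha : (fun i => (Fin.natAdd (k + 1) q : Fin (k + 1 + l + 1)).insertNth (α := fun _ => V) x
        (v ∘ τ) (Fin.castAdd (l + 1) i)) =
        fun i => v (τ (Fin.castAdd l i)) := by
      funext i
      have : (Fin.castAdd (l + 1) i : Fin (k + 1 + l + 1)) =
          (Fin.natAdd (k + 1) q : Fin (k + 1 + l + 1)).succAbove (Fin.castAdd l i) := by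
        ext
        simp only [Fin.succAbove, Fin.lt_def, Fin.val_castAdd, Fin.val_castSucc, Fin.val_natAdd]
        split_ifs
        · simp
        · omega
      rw [this, Fin.insertNth_apply_succAbove]
      rfl
    have hb : (fun i => (Fin.natAdd (k + 1) q : Fin (k + 1 + l + 1)).insertNth (α := fun _ => V) x
        (v ∘ τ) (Fin.natAdd (k + 1) i)) =
        q.insertNth x (fun i => v (τ (Fin.natAdd (k + 1) i))) := by
      funext i
      rcases Fin.eq_self_or_eq_succAbove q i with rfl | ⟨j, rfl⟩
      · simp
      · have : (Fin.natAdd (k + 1) (q.succAbove j) : Fin (k + 1 + l + 1)) =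
            (Fin.natAdd (k + 1) q : Fin (k + 1 + l + 1)).succAbove (Fin.natAdd (k + 1) j) := by
          ext
          simp only [Fin.succAbove, Fin.lt_def, Fin.val_castSucc, Fin.val_natAdd]
          split_ifs <;> simp <;> omega
        rw [this, Fin.insertNth_apply_succAbove, Fin.insertNth_apply_succAbove]
        rfl
    rw [ha, hb, AlternatingMap.map_insertNth, zsmul_eq_mul, Fin.val_natAdd, pow_add]
    have h1 : ((-1 : ℝ) ^ (q : ℕ)) * (-1) ^ (q : ℕ) = 1 := by rw [← mul_pow]; simp
    push_cast
    simp only [AlternatingMap.curryLeft_apply_apply]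
    linear_combination ((-1) ^ (k + 1) * ((Equiv.Perm.sign τ : ℤ) : ℝ) *
        (a (fun i => v (τ (Fin.castAdd l i))) *
          b (Matrix.vecCons x (fun i => v (τ (Fin.natAdd (k + 1) i)))))) * h1
  simp only [hL, hR, Finset.sum_const, Finset.card_univ, Fintype.card_fin, nsmul_eq_mul]
  rw [← Finset.mul_sum, ← factorial_mul_wedge_apply]
  have hcast : ∑ τ : Equiv.Perm (Fin (k + 1 + l)), ((Equiv.Perm.sign τ : ℤ) : ℝ) *
        (a.curryLeft x (fun i => v (τ (Fin.cast hkl (Fin.castAdd (l + 1) i)))) *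
          b (fun i => v (τ (Fin.cast hkl (Fin.natAdd k i))))) =
      ∑ σ : Equiv.Perm (Fin (k + (l + 1))), ((Equiv.Perm.sign σ : ℤ) : ℝ) *
        (a.curryLeft x (fun i => (v ∘ Fin.cast hkl) (σ (Fin.castAdd (l + 1) i))) *
          b (fun i => (v ∘ Fin.cast hkl) (σ (Fin.natAdd k i)))) := by
    refine Fintype.sum_equiv (finCongr (by omega)).permCongr _ _ fun σ => ?_
    simp [Equiv.permCongr_apply]
  rw [hcast, ← factorial_mul_wedge_apply]
  push_cast [Nat.factorial_succ]
  ring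

end Wedge

section WedgePow

variable {V : Type*} [AddCommGroup V] [Module ℝ V] {W : Type*} [AddCommGroup W] [Module ℝ W]

theorem wedge_apply_eq_sum {k l : ℕ} (a : V [⋀^Fin k]→ₗ[ℝ] ℝ) (b : V [⋀^Fin l]→ₗ[ℝ] ℝ)
    (v : Fin (k + l) → V) :
    wedge a b v = ∑ σ : Equiv.Perm.ModSumCongr (Fin k) (Fin l),
      LinearMap.mul' ℝ ℝ (AlternatingMap.domCoprod.summand a b σ (v ∘ finSumFinEquiv)) := by
  rw [← map_sum, ← sum_apply]
  rfl

/-- If the first factor vanishes on all tuples that use one of the last `l` vectors, only the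
trivial shuffle contributes to the exterior product. -/
theorem wedge_apply_of_left_eq_zero {k l : ℕ} (a : V [⋀^Fin k]→ₗ[ℝ] ℝ) (b : V [⋀^Fin l]→ₗ[ℝ] ℝ)
    (v : Fin (k + l) → V)
    (h : ∀ u : Fin k → Fin (k + l), (∃ i j, u i = Fin.natAdd k j) → a (v ∘ u) = 0) :
    wedge a b v = a (fun i => v (Fin.castAdd l i)) * b (fun i => v (Fin.natAdd k i)) := by
  rw [wedge_apply_eq_sum]
  refine (Finset.sum_eq_single (Quotient.mk'' 1 : Equiv.Perm.ModSumCongr (Fin k) (Fin l)) ?_ ?_).trans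
    ?_
  rotate_left 2
  · rw [AlternatingMap.domCoprod.summand_mk'']
    simp [MultilinearMap.domCoprod_apply]
  · intro σ _ hσ
    induction σ using Quotient.inductionOn' with | _ σ
    rw [AlternatingMap.domCoprod.summand_mk'']
    have hex : ∃ i j, σ (Sum.inl i) = Sum.inr j := by
      by_contra hcon
      push Not at hcon
      apply hσ
      refine Quotient.sound' ?_
      rw [QuotientGroup.leftRel_apply, mul_one]
      refine inv_mem (Equiv.Perm.mem_sumCongrHom_range_of_perm_mapsTo_inl ?_)
      rintro _ ⟨i, rfl⟩
      rcases hi : σ (Sum.inl i) with i' | j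
      · exact ⟨i', rfl⟩
      · exact (hcon i j hi).elim
    obtain ⟨i, j, hij⟩ := hex
    have h0 := h (fun i => finSumFinEquiv (σ (Sum.inl i))) ⟨i, j, by rw [hij]; simp⟩
    have : (a fun i => v (finSumFinEquiv (σ (Sum.inl i)))) = 0 := h0
    simp [MultilinearMap.domCoprod_apply, this]
  · simp

/-- The exterior product of a 1-form with a form, evaluated on a vector and on vectors that the
1-form annihilates. -/
theorem wedge_one_form_apply {l : ℕ} (φ : V [⋀^Fin 1]→ₗ[ℝ] ℝ) (b : V [⋀^Fin l]→ₗ[ℝ] ℝ)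
    (v : Fin (1 + l) → V) (h : ∀ i, φ ![v (Fin.natAdd 1 i)] = 0) :
    wedge φ b v = φ ![v (Fin.castAdd l 0)] * b (fun i => v (Fin.natAdd 1 i)) := by
  rw [wedge_apply_of_left_eq_zero]
  · congr 2
    funext i
    fin_cases i
    rfl
  · rintro u ⟨i, j, hij⟩
    rw [← h j]
    congr 1
    funext i'
    fin_cases i'
    fin_cases i
    simp only [Function.comp_apply]
    exact congrArg v hij

theorem wedgePow_one_apply (η : V [⋀^Fin 2]→ₗ[ℝ] ℝ) (v : Fin 2 → V) :
    (wedgePow η 1 : V [⋀^Fin 2]→ₗ[ℝ] ℝ) v = η v := by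
  refine (wedge_apply_of_left_eq_zero (k := 0) (wedgePow η 0) η v ?_).trans ?_
  · rintro u ⟨i, -⟩
    exact i.elim0
  · refine (one_mul _).trans (congrArg η (funext fun i => congrArg v ?_))
    ext
    simp

theorem wedgePow_compLinearMap (η : V [⋀^Fin 2]→ₗ[ℝ] ℝ) (L : W →ₗ[ℝ] V) (j : ℕ) :
    (wedgePow η j).compLinearMap L = wedgePow (η.compLinearMap L) j := by
  induction j with
  | zero => rfl
  | succ j ih => exact (wedge_compLinearMap _ _ _).trans (by rw [ih]; rfl)

theorem wedgePow_smul (c : ℝ) (η : V [⋀^Fin 2]→ₗ[ℝ] ℝ) (j : ℕ) :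
    wedgePow (c • η) j = c ^ j • wedgePow η j := by
  induction j with
  | zero => rw [pow_zero, one_smul]; rfl
  | succ j ih =>
    change wedge (wedgePow (c • η) j) (c • η) = _
    rw [ih, smul_wedge_smul, ← pow_succ]
    rfl

/-- The contraction of the power `η^(j+1)` with the vector `e`. -/
def contractPow (η : V [⋀^Fin 2]→ₗ[ℝ] ℝ) (e : V) (j : ℕ) : V [⋀^Fin (2 * j + 1)]→ₗ[ℝ] ℝ :=
  AlternatingMap.curryLeft (n := 2 * j + 1) (wedgePow η (j + 1)) e

theorem contractPow_zero (η : V [⋀^Fin 2]→ₗ[ℝ] ℝ) (e : V) :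
    contractPow η e 0 = η.curryLeft e := by
  ext v
  exact wedgePow_one_apply η _

theorem contractPow_succ (η : V [⋀^Fin 2]→ₗ[ℝ] ℝ) (e : V) (j : ℕ) :
    contractPow η e (j + 1) =
      wedge (contractPow η e j) η +
        wedge (l := 1) (wedgePow η (j + 1)) (η.curryLeft e) := by
  ext v
  refine (wedge_cons (k := 2 * j + 1) (l := 1) (wedgePow η (j + 1)) η e v).trans ?_
  rw [Even.neg_one_pow ⟨j + 1, by ring⟩, one_mul]
  rfl

theorem contractPow_compLinearMap_eq_zero (η : V [⋀^Fin 2]→ₗ[ℝ] ℝ) (e : V) (L : W →ₗ[ℝ] V)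
    (h : ∀ w, η ![e, L w] = 0) (j : ℕ) : (contractPow η e j).compLinearMap L = 0 := by
  have h1 : (η.curryLeft e).compLinearMap L = 0 := by
    ext w
    refine Eq.trans (congrArg η (funext fun i => ?_)) (h (w 0))
    fin_cases i <;> rfl
  induction j with
  | zero => rw [contractPow_zero]; exact h1
  | succ j ih =>
    rw [contractPow_succ]
    ext w
    have e1 := congrArg (fun f => f w) (wedge_compLinearMap (contractPow η e j) η L)
    have e2 := congrArg (fun f => f w) (wedge_compLinearMap (l := 1) (wedgePow η (j + 1))
      (η.curryLeft e) L)
    rw [ih, zero_wedge] at e1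
    rw [h1, wedge_zero] at e2
    exact (congrArg₂ (· + ·) e1 e2).trans (by simp)

theorem contractPow_curryLeft_compLinearMap (η : V [⋀^Fin 2]→ₗ[ℝ] ℝ) (e u : V) (L : W →ₗ[ℝ] V)
    (h : ∀ w, η ![e, L w] = 0) (j : ℕ) :
    ((contractPow η e j).curryLeft u).compLinearMap L =
      ((j + 1) * η ![e, u]) • (wedgePow η j).compLinearMap L := by
  have h1 : (η.curryLeft e).compLinearMap L = 0 := by
    have := contractPow_compLinearMap_eq_zero η e L h 0
    rwa [contractPow_zero] at this
  induction j with
  | zero =>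
    ext w
    rw [contractPow_zero]
    refine Eq.trans (congrArg η (funext fun i => ?_)) (show η ![e, u] = _ from ?_)
    · fin_cases i <;> rfl
    · simp [wedgePow]
  | succ j ih =>
    ext w
    have e1 := wedge_cons (k := 2 * j) (l := 1) (contractPow η e j) η u (L ∘ w)
    have e2 := wedge_cons (k := 2 * j + 1) (l := 0) (wedgePow η (j + 1)) (η.curryLeft e) u (L ∘ w)
    have e3 := congrArg (fun f => f w) (wedge_compLinearMap ((contractPow η e j).curryLeft u) η L)
    have e4 := congrArg (fun f => f w)
      (wedge_compLinearMap (l := 1) (contractPow η e j) (η.curryLeft u) L)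
    have e5 := congrArg (fun f => f w) (wedge_compLinearMap (k := 2 * j + 1) (l := 1)
      (AlternatingMap.curryLeft (n := 2 * j + 1) (wedgePow η (j + 1)) u) (η.curryLeft e) L)
    have e6 := wedge_apply_of_left_eq_zero (l := 0) (wedgePow η (j + 1))
      ((η.curryLeft e).curryLeft u) (L ∘ w) (by rintro _ ⟨_, i, _⟩; exact i.elim0)
    rw [contractPow_compLinearMap_eq_zero η e L h, zero_wedge] at e4
    rw [h1, wedge_zero] at e5
    rw [ih, ← one_smul ℝ (η.compLinearMap L), smul_wedge_smul, wedgePow_compLinearMap] at e3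
    rw [wedgePow_compLinearMap, contractPow_succ]
    have e7 : ((η.curryLeft e).curryLeft u) (fun i => (L ∘ w) (Fin.natAdd (2 * (j + 1)) i)) =
        η ![e, u] := congrArg η (funext fun i => by fin_cases i <;> rfl)
    have e8 : wedgePow η (j + 1) (fun i => (L ∘ w) (Fin.castAdd 0 i)) =
        wedgePow (η.compLinearMap L) (j + 1) w := by
      rw [← wedgePow_compLinearMap]
      rfl
    rw [e7, e8] at e6
    refine (congrArg₂ (· + ·) e1 e2).trans ?_
    have e3' : wedge ((contractPow η e j).curryLeft u) η (L ∘ w) =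
      ((j + 1) * η ![e, u] * 1) • wedgePow (η.compLinearMap L) (j + 1) w := e3
    have e4' : wedge (l := 1) (contractPow η e j) (η.curryLeft u) (L ∘ w) = 0 := e4
    have e5' : wedge (k := 2 * j + 1) (l := 1)
      (AlternatingMap.curryLeft (n := 2 * j + 1) (wedgePow η (j + 1)) u) (η.curryLeft e) (L ∘ w)
        = 0 := e5
    refine (congrArg₂ (· + ·) (congrArg₂ (· + ·) e3' (congrArg (_ * ·) e4'))
      (congrArg₂ (· + ·) e5' (congrArg (_ * ·) e6))).trans ?_
    rw [Even.neg_one_pow (n := 2 * j + 1 + 1) ⟨j + 1, by ring⟩]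
    simp only [smul_eq_mul, AlternatingMap.smul_apply]
    push_cast
    ring

end WedgePow

section LinearAlgebra

variable {V : Type*} [AddCommGroup V] [Module ℝ V]

theorem exists_basis_cons_mem_ker [FiniteDimensional ℝ V] {n : ℕ}
    (hn : Module.finrank ℝ V = n + 1) (φ : V →ₗ[ℝ] ℝ) (u : V)
    (hu : φ u ≠ 0) :
    ∃ (b : Module.Basis (Fin (n + 1)) ℝ V) (c : Module.Basis (Fin n) ℝ (LinearMap.ker φ)),
      ⇑b = Fin.cons u (fun i => (c i : V)) := by
  have hφ : LinearMap.range φ = ⊤ :=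
    LinearMap.range_eq_top.2 (LinearMap.surjective fun h => hu (by simp [h]))
  have hk : Module.finrank ℝ (LinearMap.ker φ) = n := by
    have := φ.finrank_range_add_finrank_ker
    rw [hφ, finrank_top, Module.finrank_self, hn] at this
    omega
  refine ⟨Module.Basis.mkFinCons u (Module.finBasisOfFinrankEq ℝ _ hk) ?_ ?_,
    Module.finBasisOfFinrankEq ℝ _ hk, ?_⟩
  · intro c x hx h
    have := congrArg φ h
    rw [map_add, map_smul, LinearMap.mem_ker.1 hx, map_zero, smul_eq_mul, add_zero] at this
    exact (mul_eq_zero.1 this).resolve_right hu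
  · intro z
    refine ⟨-(φ z / φ u), ?_⟩
    rw [LinearMap.mem_ker, map_add, map_smul, smul_eq_mul]
    field_simp
    ring
  · rw [Module.Basis.coe_mkFinCons]
    rfl

theorem AlternatingMap.eq_zero_of_card_gt [FiniteDimensional ℝ V] {k : ℕ} (f : V [⋀^Fin k]→ₗ[ℝ] ℝ)
    (h : Module.finrank ℝ V < k) : f = 0 := by
  ext v
  refine f.map_linearDependent v fun hv => ?_
  have := hv.fintype_card_le_finrank
  simp at this
  omega

theorem eq_zero_of_wedgePow_ne_zero [FiniteDimensional ℝ V] {m : ℕ} (hm : Module.finrank ℝ V = 2 * m)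
    (η : V [⋀^Fin 2]→ₗ[ℝ] ℝ) (hη : wedgePow η m ≠ 0) (v : V) (hv : ∀ w, η ![v, w] = 0) :
    v = 0 := by
  cases m with
  | zero =>
    have := Module.finrank_zero_iff.1 hm
    exact Subsingleton.elim _ _
  | succ j =>
    by_contra hv0
    obtain ⟨φ, hφ⟩ : ∃ φ : Module.Dual ℝ V, φ v ≠ 0 := by
      by_contra! hcon
      exact hv0 ((Module.forall_dual_apply_eq_zero_iff ℝ v).1 hcon)
    obtain ⟨b, c, hb⟩ := exists_basis_cons_mem_ker (n := 2 * j + 1) hm φ v hφ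
    refine (AlternatingMap.map_basis_ne_zero_iff b (wedgePow η (j + 1))).2 hη ?_
    rw [hb]
    have := congrArg (fun f => f (fun i => (c i : V)))
      (contractPow_compLinearMap_eq_zero η v LinearMap.id hv j)
    exact this

/-- A 1-form regarded as a linear functional. -/
def oneFormFunctional (a : V [⋀^Fin 1]→ₗ[ℝ] ℝ) : V →ₗ[ℝ] ℝ :=
  (AlternatingMap.ofSubsingleton ℝ V ℝ (0 : Fin 1)).symm a

theorem oneFormFunctional_apply (a : V [⋀^Fin 1]→ₗ[ℝ] ℝ) (v : V) :
    oneFormFunctional a v = a ![v] :=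
  congrArg a (funext fun i => by fin_cases i; rfl)

theorem wedge_wedgePow_suspension_ne_zero {k : ℕ} {t : ℝ} (ht : t ≠ 0)
    (a : V [⋀^Fin 1]→ₗ[ℝ] ℝ) (w : V [⋀^Fin 2]→ₗ[ℝ] ℝ) (A : (V × ℝ) [⋀^Fin 1]→ₗ[ℝ] ℝ)
    (Ω : (V × ℝ) [⋀^Fin 2]→ₗ[ℝ] ℝ) (hA : ∀ v s, A ![(v, s)] = t * a ![v] + s)
    (hΩ : ∀ v s v' s', Ω ![(v, s), (v', s')] = s * a ![v'] - s' * a ![v] + t * w ![v, v'])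
    (hw : wedgePow w k ≠ 0) :
    wedge A (wedgePow Ω k) ≠ 0 := by
  obtain ⟨v, hv⟩ : ∃ v, wedgePow w k v ≠ 0 := by
    by_contra! hcon
    exact hw (AlternatingMap.ext hcon)
  let L : V →ₗ[ℝ] V × ℝ := LinearMap.prod LinearMap.id (-t • oneFormFunctional a)
  have hL : ∀ v, L v = (v, -t * a ![v]) := fun v => by
    simp [L, oneFormFunctional_apply]
  have hLw : Ω.compLinearMap L = t • w := by
    ext v
    have hv : v = ![v 0, v 1] := by ext i; fin_cases i <;> rfl
    have h1 : (fun i => L (v i)) = ![L (v 0), L (v 1)] := by ext i <;> fin_cases i <;> rfl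
    rw [AlternatingMap.compLinearMap_apply, AlternatingMap.smul_apply]
    refine (congrArg Ω h1).trans ?_
    rw [hL, hL, hΩ, ← hv, smul_eq_mul]
    ring
  intro h0
  have h1 := wedge_one_form_apply A (wedgePow Ω k)
    (Fin.append (m := 1) ![((0 : V), (1 : ℝ))] (L ∘ v)) (fun i => by
      rw [Fin.append_right, Function.comp_apply, hL, hA]
      ring)
  rw [h0, Fin.append_left] at h1
  have h2 : wedgePow Ω k (fun i => Fin.append (m := 1) ![((0 : V), (1 : ℝ))] (L ∘ v)
      (Fin.natAdd 1 i)) = t ^ k * wedgePow w k v := by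
    have h4 := congrArg (fun f => f v) (wedgePow_smul t w k)
    rw [← hLw, ← wedgePow_compLinearMap] at h4
    exact (congrArg _ (funext fun i => Fin.append_right _ _ i)).trans h4
  rw [h2] at h1
  have h3 : A ![(![((0 : V), (1 : ℝ))] : Fin 1 → V × ℝ) 0] = 1 := by
    refine (hA 0 1).trans ?_
    rw [← oneFormFunctional_apply, map_zero]
    ring
  rw [h3] at h1
  exact mul_ne_zero (pow_ne_zero k ht) hv (by simpa using h1.symm)

theorem wedgePow_suspension_ne_zero [FiniteDimensional ℝ V] {k : ℕ} {t : ℝ} (ht : t ≠ 0)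
    (a : V [⋀^Fin 1]→ₗ[ℝ] ℝ) (w : V [⋀^Fin 2]→ₗ[ℝ] ℝ) (Ω : (V × ℝ) [⋀^Fin 2]→ₗ[ℝ] ℝ)
    (hΩ : ∀ v s v' s', Ω ![(v, s), (v', s')] = s * a ![v'] - s' * a ![v] + t * w ![v, v'])
    (hn : Module.finrank ℝ V = 2 * k + 1) (hw : wedge a (wedgePow w k) ≠ 0) : wedgePow Ω (k + 1) ≠ 0 := by
  obtain ⟨u, hu⟩ : ∃ u, oneFormFunctional a u ≠ 0 := by
    by_contra! hcon
    apply hw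
    have : a = 0 := by
      ext v
      rw [show v = ![v 0] from by ext i; fin_cases i; rfl, ← oneFormFunctional_apply, hcon]
      rfl
    rw [this, zero_wedge]
  obtain ⟨b, c, hb⟩ := exists_basis_cons_mem_ker hn (oneFormFunctional a) u hu
  let b' := b.reindex (finCongr (show 2 * k + 1 = 1 + 2 * k by omega))
  have hc : ∀ x : LinearMap.ker (oneFormFunctional a), a ![(x : V)] = 0 := fun x => by
    rw [← oneFormFunctional_apply]
    exact x.2
  have hb0 : b' (Fin.castAdd (2 * k) 0) = u := by
    have : b 0 = u := by rw [hb]; rfl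
    rw [← this]
    simp only [b', Module.Basis.reindex_apply]
    rfl
  have hbs : ∀ i, b' (Fin.natAdd 1 i) = c i := fun i => by
    have h1 : b i.succ = c i := by rw [hb]; rfl
    rw [← h1]
    simp only [b', Module.Basis.reindex_apply]
    congr 1
    ext
    simp
  have h1 := (AlternatingMap.map_basis_ne_zero_iff b' _).2 hw
  rw [wedge_one_form_apply _ _ _ (fun i => by rw [hbs, hc])] at h1
  have h2 := right_ne_zero_of_mul h1
  simp only [hbs] at h2
  let L : LinearMap.ker (oneFormFunctional a) →ₗ[ℝ] V × ℝ :=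
    LinearMap.inl ℝ V ℝ ∘ₗ (LinearMap.ker (oneFormFunctional a)).subtype
  have hL : ∀ x, L x = ((x : V), 0) := fun x => rfl
  have ha0 : a ![0] = 0 := by rw [← oneFormFunctional_apply, map_zero]
  have hw0 : ∀ v, w ![0, v] = 0 := fun v => w.map_coord_zero 0 rfl
  have key := congrArg (fun f => f c) (contractPow_curryLeft_compLinearMap Ω (0, 1) (u, 0) L
    (fun x => by rw [hL, hΩ, hc, hw0]; ring) k)
  have hLw : Ω.compLinearMap L = t • w.compLinearMap (Submodule.subtype _) := by
    ext v
    have h1 : (fun i => L (v i)) = ![L (v 0), L (v 1)] := by ext i <;> fin_cases i <;> rfl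
    have h2 : (fun i => (v i : V)) = ![(v 0 : V), (v 1 : V)] := by ext i; fin_cases i <;> rfl
    refine (congrArg Ω h1).trans ?_
    rw [hL, hL, hΩ, AlternatingMap.smul_apply, smul_eq_mul]
    refine Eq.trans ?_ (congrArg (t * w ·) h2.symm)
    ring
  rw [wedgePow_compLinearMap, hLw, wedgePow_smul, ← wedgePow_compLinearMap, hΩ, ha0, hw0] at key
  intro h0
  have h3 : (((contractPow Ω (0, 1) k).curryLeft (u, 0)).compLinearMap L) c = 0 := by
    have : contractPow Ω (0, 1) k = 0 := by
      rw [contractPow, h0]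
      rfl
    rw [this]
    rfl
  have h4 := key.symm.trans h3
  rw [oneFormFunctional_apply] at hu
  have h5 : ((k : ℝ) + 1) ≠ 0 := by positivity
  refine mul_ne_zero (mul_ne_zero h5 hu) (mul_ne_zero (pow_ne_zero k ht) h2) ?_
  simp only [AlternatingMap.smul_apply, smul_eq_mul] at h4
  rw [← h4]
  simp only [one_mul, mul_zero, sub_zero, add_zero]
  rfl

end LinearAlgebra

section Charts

open Set Filter Topology

variable {E : Type*} [NormedAddCommGroup E] [NormedSpace ℝ E]
  {H : Type*} [TopologicalSpace H] (I : ModelWithCorners ℝ E H)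
  {M : Type*} [TopologicalSpace M] [ChartedSpace H M]

theorem DiffForm.apply_congr {k : ℕ} (η : DiffForm I M k) {x y : M} (h : x = y) (v : Fin k → E) :
    (η x : E [⋀^Fin k]→L[ℝ] ℝ) v = (η y : E [⋀^Fin k]→L[ℝ] ℝ) v := by
  subst h
  rfl

theorem chartRep_extChartAt_self [IsManifold I 1 M] {k : ℕ} (η : DiffForm I M k) (x : M) :
    chartRep I η x (extChartAt I x x) = (η x : E [⋀^Fin k]→L[ℝ] ℝ) := by
  ext v
  have h : mfderivWithin 𝓘(ℝ, E) I (extChartAt I x).symm (range I) (extChartAt I x x) =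
      ContinuousLinearMap.id ℝ E := mfderivWithin_range_extChartAt_symm
  refine Eq.trans ?_ (DiffForm.apply_congr I η (extChartAt_to_inv (I := I) x) v)
  exact congrArg (η ((extChartAt I x).symm (extChartAt I x x)))
    (funext fun i => congrArg (fun f : E →L[ℝ] E => f (v i)) h)

theorem extD_eq [IsManifold I 1 M] [I.Boundaryless] {k : ℕ} (η : DiffForm I M k) (x : M) :
    (extD I η x : E [⋀^Fin (k + 1)]→L[ℝ] ℝ) =
      extDeriv (chartRep I η x) (extChartAt I x x) := by
  ext v
  have h : mfderiv I 𝓘(ℝ, E) (extChartAt I x) x = ContinuousLinearMap.id ℝ E :=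
    mfderiv_extChartAt_self
  rw [← extDerivWithin_univ, ← I.range_eq_univ]
  exact congrArg (extDerivWithin (chartRep I η x) (range I) (extChartAt I x x))
    (funext fun i => congrArg (fun f : E →L[ℝ] E => f (v i)) h)

theorem chartRep_coordChange [IsManifold I 1 M] [I.Boundaryless] {k : ℕ} (η : DiffForm I M k)
    (x₀ x : M) {z : E} (hz : z ∈ (extChartAt I x₀).target)
    (hzx : (extChartAt I x₀).symm z ∈ (extChartAt I x).source) :
    chartRep I η x₀ z =
      (chartRep I η x ((extChartAt I x ∘ (extChartAt I x₀).symm) z)).compContinuousLinearMap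
        (fderiv ℝ (extChartAt I x ∘ (extChartAt I x₀).symm) z) := by
  have hd0 := mdifferentiableWithinAt_extChartAt_symm (I := I) hz
  have hd1 := mdifferentiableWithinAt_extChartAt_symm (I := I) ((extChartAt I x).map_source hzx)
  have hd2 := mdifferentiableAt_extChartAt (I := I) (x := x) (by rwa [← extChartAt_source (I := I)])
  have hf : mfderivWithin 𝓘(ℝ, E) 𝓘(ℝ, E) (extChartAt I x ∘ (extChartAt I x₀).symm) (range I) z =
      fderiv ℝ (extChartAt I x ∘ (extChartAt I x₀).symm) z := by
    rw [I.range_eq_univ, mfderivWithin_univ, mfderiv_eq_fderiv]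
  have hU : UniqueMDiffWithinAt 𝓘(ℝ, E) (range I) z := by
    rw [I.range_eq_univ]; exact uniqueMDiffWithinAt_univ _
  have key : mfderivWithin 𝓘(ℝ, E) I (extChartAt I x₀).symm (range I) z =
      (mfderivWithin 𝓘(ℝ, E) I (extChartAt I x).symm (range I)
        ((extChartAt I x ∘ (extChartAt I x₀).symm) z)).comp
      (mfderivWithin 𝓘(ℝ, E) 𝓘(ℝ, E) (extChartAt I x ∘ (extChartAt I x₀).symm) (range I) z) := by
    have hmaps : MapsTo (extChartAt I x ∘ (extChartAt I x₀).symm) (range I) (range I) := by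
      rw [I.range_eq_univ]
      exact mapsTo_univ _ _
    refine Eq.trans ?_ (mfderivWithin_comp (I' := 𝓘(ℝ, E)) z hd1
      (hd2.comp_mdifferentiableWithinAt z hd0) hmaps hU)
    have hnear : ∀ᶠ z' in 𝓝[range I] z, (extChartAt I x₀).symm z' =
        ((extChartAt I x).symm ∘ (extChartAt I x ∘ (extChartAt I x₀).symm)) z' := by
      have hc : ContinuousWithinAt (extChartAt I x₀).symm (range I) z := hd0.continuousWithinAt
      filter_upwards [hc ((isOpen_extChartAt_source (I := I) x).mem_nhds hzx)] with z' hz'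
      exact ((extChartAt I x).left_inv hz').symm
    refine Filter.EventuallyEq.mfderivWithin_eq hnear ?_
    exact ((extChartAt I x).left_inv hzx).symm
  ext v
  refine (DiffForm.apply_congr I η ((extChartAt I x).left_inv hzx).symm _).trans ?_
  refine congrArg (η ((extChartAt I x).symm ((extChartAt I x ∘ (extChartAt I x₀).symm) z)))
    (funext fun i => ?_)
  refine (congrArg (fun f : E →L[ℝ] E => f (v i)) key).trans ?_
  rw [hf]
  rfl

theorem contDiffAt_chartRep [I.Boundaryless] {k : ℕ} {η : DiffForm I M k} (hη : IsSmoothForm I η)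
    (x₀ : M) {z : E} (hz : z ∈ (extChartAt I x₀).target) : ContDiffAt ℝ ∞ (chartRep I η x₀) z :=
  (hη x₀).contDiffAt ((isOpen_extChartAt_target x₀).mem_nhds hz)

/-- In every chart, the exterior derivative on the manifold is the exterior derivative of the
coordinate expression. -/
theorem chartRep_extD [IsManifold I ∞ M] [I.Boundaryless] {k : ℕ} {η : DiffForm I M k}
    (hη : IsSmoothForm I η) (x₀ : M) {z : E} (hz : z ∈ (extChartAt I x₀).target) :
    chartRep I (extD I η) x₀ z = extDeriv (chartRep I η x₀) z := by
  have : IsManifold I 1 M := IsManifold.of_le (n := ∞) (by exact_mod_cast le_top)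
  set x := (extChartAt I x₀).symm z with hx
  set f := extChartAt I x ∘ (extChartAt I x₀).symm with hf
  have hfz : f z = extChartAt I x x := rfl
  have hzx : (extChartAt I x₀).symm z ∈ (extChartAt I x).source := mem_extChartAt_source x
  have hnear : chartRep I η x₀ =ᶠ[𝓝 z] fun z' =>
      (chartRep I η x (f z')).compContinuousLinearMap (fderiv ℝ f z') := by
    have hc : ContinuousAt (extChartAt I x₀).symm z :=
      (continuousOn_extChartAt_symm x₀).continuousAt ((isOpen_extChartAt_target x₀).mem_nhds hz)
    filter_upwards [(isOpen_extChartAt_target (I := I) x₀).mem_nhds hz,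
      hc ((isOpen_extChartAt_source (I := I) x).mem_nhds hzx)] with z' hz' hzx'
    exact chartRep_coordChange I η x₀ x hz' hzx'
  have hfs : ContDiffAt ℝ ∞ f z := by
    have := contDiffWithinAt_ext_coord_change (I := I) (n := ∞) x x₀ (y := z) (by
      rw [PartialEquiv.trans_source]
      exact ⟨hz, hzx⟩)
    rwa [I.range_eq_univ, contDiffWithinAt_univ] at this
  have hω : ContDiffAt ℝ ∞ (chartRep I η x) (f z) := by
    rw [hfz]
    exact contDiffAt_chartRep I hη x (mem_extChartAt_target x)
  rw [hnear.extDeriv_eq, extDeriv_pullback (hω.differentiableAt (by simp)) hfs (by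
      rw [minSmoothness_of_isRCLikeNormedField]; exact WithTop.coe_le_coe.2 (le_top : (2 : ℕ∞) ≤ ⊤)),
    chartRep_coordChange I (extD I η) x₀ x hz hzx]
  congr 1
  change chartRep I (extD I η) x (extChartAt I x x) = extDeriv (chartRep I η x) (extChartAt I x x)
  rw [chartRep_extChartAt_self, extD_eq]

theorem isSmoothForm_extD [IsManifold I ∞ M] [I.Boundaryless] {k : ℕ} {η : DiffForm I M k}
    (hη : IsSmoothForm I η) : IsSmoothForm I (extD I η) := by
  intro x₀
  refine ContDiffOn.congr ?_ (fun z hz => chartRep_extD I hη x₀ hz)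
  intro z hz
  refine ContDiffAt.contDiffWithinAt ?_
  exact (ContinuousAlternatingMap.alternatizeUncurryFinCLM ℝ E ℝ).contDiff.contDiffAt.comp z
    ((contDiffAt_chartRep I hη x₀ hz).fderiv_right (m := ∞) (by simp))

theorem extD_extD [IsManifold I ∞ M] [I.Boundaryless] {k : ℕ} {η : DiffForm I M k}
    (hη : IsSmoothForm I η) (x : M) : extD I (extD I η) x = 0 := by
  have : IsManifold I 1 M := IsManifold.of_le (n := ∞) (by exact_mod_cast le_top)
  have hz := mem_extChartAt_target (I := I) x
  have hnear : chartRep I (extD I η) x =ᶠ[𝓝 (extChartAt I x x)] extDeriv (chartRep I η x) := by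
    filter_upwards [(isOpen_extChartAt_target (I := I) x).mem_nhds hz] with z' hz'
    exact chartRep_extD I hη x hz'
  refine (extD_eq I (extD I η) x).trans ?_
  rw [hnear.extDeriv_eq]
  exact extDeriv_extDeriv_apply (contDiffAt_chartRep I hη x hz) (by
      rw [minSmoothness_of_isRCLikeNormedField]; exact WithTop.coe_le_coe.2 (le_top : (2 : ℕ∞) ≤ ⊤))

end Charts

section SuspensionForm

open Set Filter Topology

variable {E : Type*} [NormedAddCommGroup E] [NormedSpace ℝ E]
  {H : Type*} [TopologicalSpace H] (I : ModelWithCorners ℝ E H)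
  {M : Type*} [TopologicalSpace M] [ChartedSpace H M]

/-- The form `s β + ds` on `E × ℝ` attached to a 1-form `β` on `E`. -/
def suspensionRep (β : E → E [⋀^Fin 1]→L[ℝ] ℝ) (z : E × ℝ) : (E × ℝ) [⋀^Fin 1]→L[ℝ] ℝ :=
  z.2 • (β z.1).compContinuousLinearMap (ContinuousLinearMap.fst ℝ E ℝ) +
    ContinuousAlternatingMap.ofSubsingleton ℝ (E × ℝ) ℝ (0 : Fin 1)
      (ContinuousLinearMap.snd ℝ E ℝ)

theorem suspensionRep_apply (β : E → E [⋀^Fin 1]→L[ℝ] ℝ) (z : E × ℝ) (v : Fin 1 → E × ℝ) :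
    suspensionRep β z v = z.2 * β z.1 ![(v 0).1] + (v 0).2 := by
  have : (fun i => (v i).1) = ![(v 0).1] := by
    funext i; fin_cases i; rfl
  rw [← this]
  rfl

theorem chartRep_suspensionForm [IsManifold I 1 M] [I.Boundaryless] (α : DiffForm I M 1)
    (p : M × ℝˣ) {z : E × ℝ} (hz : z ∈ (extChartAt (I.prod 𝓘(ℝ, ℝ)) p).target) :
    chartRep (I.prod 𝓘(ℝ, ℝ)) (suspensionForm I α) p z =
      suspensionRep (chartRep I α p.1) z := by
  have hz' : z.1 ∈ (extChartAt I p.1).target ∧ z.2 ∈ (extChartAt 𝓘(ℝ, ℝ) p.2).target := by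
    rw [extChartAt_prod] at hz
    exact hz
  have hfst : ∀ z : E × ℝ, ((extChartAt (I.prod 𝓘(ℝ, ℝ)) p).symm z).1 =
      (extChartAt I p.1).symm z.1 := fun z => rfl
  have hsnd : ∀ z : E × ℝ, z ∈ (extChartAt (I.prod 𝓘(ℝ, ℝ)) p).target →
      (((extChartAt (I.prod 𝓘(ℝ, ℝ)) p).symm z).2 : ℝ) = z.2 := fun z hz => by
    have hz2 : z.2 ∈ (extChartAt 𝓘(ℝ, ℝ) p.2).target := by
      rw [extChartAt_prod] at hz
      exact hz.2
    exact (extChartAt 𝓘(ℝ, ℝ) p.2).right_inv hz2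
  have hd := mdifferentiableWithinAt_extChartAt_symm hz
  have hU : UniqueMDiffWithinAt 𝓘(ℝ, E × ℝ) (range (I.prod 𝓘(ℝ, ℝ))) z := by
    rw [ModelWithCorners.range_eq_univ]; exact uniqueMDiffWithinAt_univ _
  have hD1 : (mfderiv (I.prod 𝓘(ℝ, ℝ)) I (Prod.fst : M × ℝˣ → M)
      ((extChartAt (I.prod 𝓘(ℝ, ℝ)) p).symm z)).comp
      (mfderivWithin 𝓘(ℝ, E × ℝ) (I.prod 𝓘(ℝ, ℝ)) (extChartAt (I.prod 𝓘(ℝ, ℝ)) p).symm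
        (range (I.prod 𝓘(ℝ, ℝ))) z) =
      ((mfderivWithin 𝓘(ℝ, E) I (extChartAt I p.1).symm (range I) z.1).comp
        (ContinuousLinearMap.fst ℝ E ℝ) : E × ℝ →L[ℝ] E) := by
    have hd' := mdifferentiableWithinAt_extChartAt_symm (I := I) hz'.1
    have hd1 : MDifferentiableWithinAt 𝓘(ℝ, E × ℝ) 𝓘(ℝ, E) (Prod.fst : E × ℝ → E)
        (range (I.prod 𝓘(ℝ, ℝ))) z :=
      differentiableAt_fst.mdifferentiableAt.mdifferentiableWithinAt
    have hmaps : MapsTo (Prod.fst : E × ℝ → E) (range (I.prod 𝓘(ℝ, ℝ))) (range I) := by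
      rw [I.range_eq_univ]
      exact mapsTo_univ _ _
    refine (mfderiv_comp_mfderivWithin z mdifferentiableAt_fst hd hU).symm.trans ?_
    refine (mfderivWithin_comp z hd' hd1 hmaps hU).trans ?_
    congr 1
    rw [ModelWithCorners.range_eq_univ, mfderivWithin_univ, mfderiv_eq_fderiv]
    exact fderiv_fst
  have hD2 : (mfderiv (I.prod 𝓘(ℝ, ℝ)) 𝓘(ℝ, ℝ) (fun q : M × ℝˣ => (q.2 : ℝ))
      ((extChartAt (I.prod 𝓘(ℝ, ℝ)) p).symm z)).comp
      (mfderivWithin 𝓘(ℝ, E × ℝ) (I.prod 𝓘(ℝ, ℝ)) (extChartAt (I.prod 𝓘(ℝ, ℝ)) p).symm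
        (range (I.prod 𝓘(ℝ, ℝ))) z) = (ContinuousLinearMap.snd ℝ E ℝ : E × ℝ →L[ℝ] ℝ) := by
    have hval : MDifferentiableAt (I.prod 𝓘(ℝ, ℝ)) 𝓘(ℝ, ℝ) (fun q : M × ℝˣ => (q.2 : ℝ))
        ((extChartAt (I.prod 𝓘(ℝ, ℝ)) p).symm z) :=
      ((Units.contMDiff_val (n := 1) (𝕜 := ℝ)).mdifferentiable one_ne_zero _).comp
        ((extChartAt (I.prod 𝓘(ℝ, ℝ)) p).symm z) mdifferentiableAt_snd
    refine (mfderiv_comp_mfderivWithin z hval hd hU).symm.trans ?_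
    have hnear : ((fun q : M × ℝˣ => (q.2 : ℝ)) ∘ (extChartAt (I.prod 𝓘(ℝ, ℝ)) p).symm)
        =ᶠ[𝓝[range (I.prod 𝓘(ℝ, ℝ))] z] Prod.snd := by
      filter_upwards [mem_nhdsWithin_of_mem_nhds ((isOpen_extChartAt_target p).mem_nhds hz)]
        with z' hz'
      exact hsnd z' hz'
    rw [hnear.mfderivWithin_eq (hsnd z hz), ModelWithCorners.range_eq_univ, mfderivWithin_univ,
      mfderiv_eq_fderiv]
    exact fderiv_snd
  ext v
  have e1 := congrArg (fun f : E × ℝ →L[ℝ] E => f (v 0)) hD1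
  have e2 := congrArg (fun f : E × ℝ →L[ℝ] ℝ => f (v 0)) hD2
  rw [suspensionRep_apply]
  refine congrArg₂ (· + ·) (congrArg₂ (· * ·) (hsnd z hz) ?_) e2
  refine congrArg (α ((extChartAt I p.1).symm z.1)) (funext fun i => ?_)
  fin_cases i
  exact e1

theorem contDiffAt_suspensionRep {β : E → E [⋀^Fin 1]→L[ℝ] ℝ} {z : E × ℝ}
    (hβ : ContDiffAt ℝ ∞ β z.1) : ContDiffAt ℝ ∞ (suspensionRep β) z := by
  refine ContDiffAt.add (ContDiffAt.smul contDiffAt_snd ?_) contDiffAt_const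
  exact (ContinuousAlternatingMap.compContinuousLinearMapCLM
    (ContinuousLinearMap.fst ℝ E ℝ)).contDiff.contDiffAt.comp z (hβ.comp z contDiffAt_fst)

theorem isSmoothForm_suspensionForm [IsManifold I 1 M] [I.Boundaryless] {α : DiffForm I M 1}
    (hα : IsSmoothForm I α) : IsSmoothForm (I.prod 𝓘(ℝ, ℝ)) (suspensionForm I α) := by
  intro p
  refine ContDiffOn.congr ?_ (fun z hz => chartRep_suspensionForm I α p hz)
  intro z hz
  refine (contDiffAt_suspensionRep ?_).contDiffWithinAt
  rw [extChartAt_prod] at hz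
  exact contDiffAt_chartRep I hα p.1 hz.1

theorem extDeriv_suspensionRep {β : E → E [⋀^Fin 1]→L[ℝ] ℝ} {z : E × ℝ}
    (hβ : ContDiffAt ℝ ∞ β z.1) (v v' : E) (s s' : ℝ) :
    extDeriv (suspensionRep β) z ![(v, s), (v', s')] =
      s * β z.1 ![v'] - s' * β z.1 ![v] + z.2 * extDeriv β z.1 ![v, v'] := by
  have hd := hβ.differentiableAt (by simp)
  rw [extDeriv_apply ((contDiffAt_suspensionRep hβ).differentiableAt (by simp)),
    extDeriv_apply hd]
  have key : ∀ (w v : E) (c s : ℝ), fderiv ℝ (fun z => suspensionRep β z ![(w, c)]) z (v, s) =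
      s * β z.1 ![w] + z.2 * fderiv ℝ (fun y => β y ![w]) z.1 v := by
    intro w v c s
    simp only [suspensionRep_apply]
    have h1 : HasFDerivAt (fun y => β y ![w]) (fderiv ℝ (fun y => β y ![w]) z.1) z.1 :=
      DifferentiableAt.hasFDerivAt (by fun_prop)
    have h2 := ((hasFDerivAt_snd (𝕜 := ℝ) (p := z)).mul (h1.comp z hasFDerivAt_fst)).add_const c
    refine (congrArg (fun f : E × ℝ →L[ℝ] ℝ => f (v, s)) h2.fderiv).trans ?_
    simp
    ring
  have hr0 : ∀ {X : Type _} (x y : X), Fin.removeNth (α := fun _ => X) 0 ![x, y] = ![y] := by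
    intro X x y; funext i; fin_cases i; rfl
  have hr1 : ∀ {X : Type _} (x y : X), Fin.removeNth (α := fun _ => X) 1 ![x, y] = ![x] := by
    intro X x y; funext i; fin_cases i; rfl
  rw [Fin.sum_univ_two, Fin.sum_univ_two, hr0, hr1, hr0, hr1]
  simp only [Matrix.cons_val_zero, Matrix.cons_val_one, key]
  simp
  ring

end SuspensionForm

section Genre

open Set Filter Topology

variable {E : Type*} [NormedAddCommGroup E] [NormedSpace ℝ E] [FiniteDimensional ℝ E]
  {H : Type*} [TopologicalSpace H] (I : ModelWithCorners ℝ E H)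
  {M : Type*} [TopologicalSpace M] [ChartedSpace H M]

/-- The degrees of the nonzero forms in the sequence `α, dα, α ∧ dα, …` at `x`. -/
def genreSet (α : DiffForm I M 1) (x : M) : Set ℕ :=
  {m : ℕ | (∃ j, m = 1 + 2 * j ∧ oddTerm I α j x ≠ 0) ∨
    (∃ j, 1 ≤ j ∧ m = 2 * j ∧ evenTerm I α j x ≠ 0)}

theorem le_finrank_of_mem_genreSet (α : DiffForm I M 1) (x : M) {m : ℕ}
    (hm : m ∈ genreSet I α x) : m ≤ Module.finrank ℝ E := by
  by_contra! hlt
  have : FiniteDimensional ℝ (TangentSpace I x) := inferInstanceAs (FiniteDimensional ℝ E)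
  rcases hm with ⟨j, rfl, h⟩ | ⟨j, -, rfl, h⟩
  · exact h (AlternatingMap.eq_zero_of_card_gt (V := TangentSpace I x) (oddTerm I α j x) hlt)
  · exact h (AlternatingMap.eq_zero_of_card_gt (V := TangentSpace I x) (evenTerm I α j x) hlt)

theorem genreAt_eq_finrank (α : DiffForm I M 1) (x : M)
    (h : Module.finrank ℝ E ∈ genreSet I α x) : genreAt I α x = Module.finrank ℝ E :=
  IsGreatest.csSup_eq (s := genreSet I α x) ⟨h, fun _ => le_finrank_of_mem_genreSet I α x⟩

theorem mem_genreSet_of_genreAt_eq (α : DiffForm I M 1) (x : M) {m : ℕ} (hm : m ≠ 0)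
    (h : genreAt I α x = m) : m ∈ genreSet I α x := by
  have hne : (genreSet I α x).Nonempty := by
    by_contra hcon
    rw [not_nonempty_iff_eq_empty] at hcon
    apply hm
    rw [← h]
    change sSup (genreSet I α x) = 0
    rw [hcon]
    exact csSup_empty
  rw [← h]
  exact Nat.sSup_mem hne ⟨_, fun _ => le_finrank_of_mem_genreSet I α x⟩

theorem evenTerm_ne_zero_of_genreAt_eq (α : DiffForm I M 1) (x : M) (k : ℕ)
    (h : genreAt I α x = 2 * k) : evenTerm I α k x ≠ 0 := by
  rcases Nat.eq_zero_or_pos k with rfl | hk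
  · intro h0
    exact one_ne_zero (congrArg (fun f => f (fun _ => 0)) h0 : (1 : ℝ) = 0)
  · rcases mem_genreSet_of_genreAt_eq I α x (by omega) h with ⟨j, hj, -⟩ | ⟨j, -, hj, h'⟩
    · omega
    · obtain rfl : k = j := by omega
      exact h'

theorem oddTerm_ne_zero_of_genreAt_eq (α : DiffForm I M 1) (x : M) (k : ℕ)
    (h : genreAt I α x = 2 * k + 1) : oddTerm I α k x ≠ 0 := by
  rcases mem_genreSet_of_genreAt_eq I α x (by omega) h with ⟨j, hj, h'⟩ | ⟨j, -, hj, -⟩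
  · obtain rfl : k = j := by omega
    exact h'
  · omega

theorem eq_zero_of_wedgePow_form_ne_zero (η : DiffForm I M 2) (x : M) {m : ℕ}
    (hm : Module.finrank ℝ E = 2 * m) (hη : wedgePow (η x).toAlternatingMap m ≠ 0)
    (v : TangentSpace I x) (hv : ∀ w : TangentSpace I x, η x ![v, w] = 0) : v = 0 :=
  have : FiniteDimensional ℝ (TangentSpace I x) := inferInstanceAs (FiniteDimensional ℝ E)
  have hm' : Module.finrank ℝ (TangentSpace I x) = 2 * m := hm
  eq_zero_of_wedgePow_ne_zero hm' (η x).toAlternatingMap hη v hv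

end Genre

section Suspension

variable {E : Type*} [NormedAddCommGroup E] [NormedSpace ℝ E]
  {H : Type*} [TopologicalSpace H] (I : ModelWithCorners ℝ E H)
  {M : Type*} [TopologicalSpace M] [ChartedSpace H M] [IsManifold I ∞ M] [I.Boundaryless]

theorem suspensionForm_apply (α : DiffForm I M 1) (p : M × ℝˣ) (v : E) (s : ℝ) :
    (suspensionForm I α p : (E × ℝ) [⋀^Fin 1]→L[ℝ] ℝ) ![(v, s)] =
      (p.2 : ℝ) * (α p.1 : E [⋀^Fin 1]→L[ℝ] ℝ) ![v] + s := by
  have : IsManifold I 1 M := IsManifold.of_le (n := ∞) (by exact_mod_cast le_top)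
  have h1 : (suspensionForm I α p : (E × ℝ) [⋀^Fin 1]→L[ℝ] ℝ) = _ :=
    (chartRep_extChartAt_self (I.prod 𝓘(ℝ, ℝ)) (suspensionForm I α) p).symm.trans
      (chartRep_suspensionForm I α p (mem_extChartAt_target p))
  have h2 : (α p.1 : E [⋀^Fin 1]→L[ℝ] ℝ) = _ := (chartRep_extChartAt_self I α p.1).symm
  rw [h1, h2]
  exact suspensionRep_apply _ _ _

theorem extD_suspensionForm_apply {α : DiffForm I M 1} (hα : IsSmoothForm I α) (p : M × ℝˣ)
    (v : E) (s : ℝ) (v' : E) (s' : ℝ) :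
    (extD (I.prod 𝓘(ℝ, ℝ)) (suspensionForm I α) p : (E × ℝ) [⋀^Fin 2]→L[ℝ] ℝ)
      ![(v, s), (v', s')] =
      s * (α p.1 : E [⋀^Fin 1]→L[ℝ] ℝ) ![v'] - s' * (α p.1 : E [⋀^Fin 1]→L[ℝ] ℝ) ![v] +
        (p.2 : ℝ) * (extD I α p.1 : E [⋀^Fin 2]→L[ℝ] ℝ) ![v, v'] := by
  have : IsManifold I 1 M := IsManifold.of_le (n := ∞) (by exact_mod_cast le_top)
  have hnear : chartRep (I.prod 𝓘(ℝ, ℝ)) (suspensionForm I α) p =ᶠ[nhds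
      (extChartAt (I.prod 𝓘(ℝ, ℝ)) p p)] suspensionRep (chartRep I α p.1) := by
    filter_upwards [(isOpen_extChartAt_target p).mem_nhds (mem_extChartAt_target p)] with z hz
    exact chartRep_suspensionForm I α p hz
  have h1 : (extD (I.prod 𝓘(ℝ, ℝ)) (suspensionForm I α) p : (E × ℝ) [⋀^Fin 2]→L[ℝ] ℝ) = _ :=
    (extD_eq (I.prod 𝓘(ℝ, ℝ)) (suspensionForm I α) p).trans hnear.extDeriv_eq
  have h2 := extDeriv_suspensionRep (z := extChartAt (I.prod 𝓘(ℝ, ℝ)) p p)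
    (contDiffAt_chartRep I hα p.1 (mem_extChartAt_target p.1)) v v' s s'
  have h3 : (extD I α p.1 : E [⋀^Fin 2]→L[ℝ] ℝ) = _ := extD_eq I α p.1
  rw [h1, h3, ← chartRep_extChartAt_self I α p.1]
  exact h2

theorem oddTerm_suspensionForm_ne_zero {α : DiffForm I M 1} (hα : IsSmoothForm I α) (p : M × ℝˣ)
    {k : ℕ} (h : evenTerm I α k p.1 ≠ 0) :
    oddTerm (I.prod 𝓘(ℝ, ℝ)) (suspensionForm I α) k p ≠ 0 :=
  wedge_wedgePow_suspension_ne_zero (V := E) p.2.ne_zero (α p.1).toAlternatingMap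
    (extD I α p.1).toAlternatingMap (suspensionForm I α p).toAlternatingMap
    (extD (I.prod 𝓘(ℝ, ℝ)) (suspensionForm I α) p).toAlternatingMap
    (suspensionForm_apply I α p) (extD_suspensionForm_apply I hα p) h

theorem evenTerm_suspensionForm_ne_zero [FiniteDimensional ℝ E] {α : DiffForm I M 1}
    (hα : IsSmoothForm I α) (p : M × ℝˣ)
    {k : ℕ} (hk : Module.finrank ℝ E = 2 * k + 1) (h : oddTerm I α k p.1 ≠ 0) :
    evenTerm (I.prod 𝓘(ℝ, ℝ)) (suspensionForm I α) (k + 1) p ≠ 0 :=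
  have : FiniteDimensional ℝ (TangentSpace I p.1) := inferInstanceAs (FiniteDimensional ℝ E)
  wedgePow_suspension_ne_zero (V := TangentSpace I p.1) p.2.ne_zero (α p.1).toAlternatingMap
    (extD I α p.1).toAlternatingMap
    (extD (I.prod 𝓘(ℝ, ℝ)) (suspensionForm I α) p).toAlternatingMap
    (extD_suspensionForm_apply I hα p) hk h

end Suspension

end

theorem proposition1 {n : ℕ} {M : Type*} [TopologicalSpace M]
    [ChartedSpace (EuclideanSpace ℝ (Fin n)) M] [IsManifold (𝓡 n) ∞ M]
    (α : DiffForm (𝓡 n) M 1) (hα : IsSmoothForm (𝓡 n) α)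
    (hnd : IsNondegeneratePair (𝓡 n) α) :
    IsSmoothForm ((𝓡 n).prod 𝓘(ℝ, ℝ)) (suspensionForm (𝓡 n) α) ∧
    IsNondegeneratePair ((𝓡 n).prod 𝓘(ℝ, ℝ)) (suspensionForm (𝓡 n) α) ∧
    (Even n → IsContactForm ((𝓡 n).prod 𝓘(ℝ, ℝ)) (suspensionForm (𝓡 n) α)) ∧
    (Odd n → IsSymplecticForm ((𝓡 n).prod 𝓘(ℝ, ℝ))
      (extD ((𝓡 n).prod 𝓘(ℝ, ℝ)) (suspensionForm (𝓡 n) α))) := by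
  have : IsManifold (𝓡 n) 1 M := IsManifold.of_le (n := ∞) (by exact_mod_cast le_top)
  have hn : Module.finrank ℝ (EuclideanSpace ℝ (Fin n)) = n := finrank_euclideanSpace_fin
  have hn' : Module.finrank ℝ (EuclideanSpace ℝ (Fin n) × ℝ) = n + 1 := by
    rw [Module.finrank_prod, hn, Module.finrank_self]
  have hs := isSmoothForm_suspensionForm (𝓡 n) hα
  have hgen : ∀ x : M, genreAt (𝓡 n) α x = n := fun x => (hnd x).trans hn
  have heven : ∀ k, n = 2 * k → ∀ p,
      oddTerm ((𝓡 n).prod 𝓘(ℝ, ℝ)) (suspensionForm (𝓡 n) α) k p ≠ 0 := fun k hk p =>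
    oddTerm_suspensionForm_ne_zero (𝓡 n) hα p
      (evenTerm_ne_zero_of_genreAt_eq (𝓡 n) α p.1 k ((hgen p.1).trans hk))
  have hodd : ∀ k, n = 2 * k + 1 → ∀ p,
      evenTerm ((𝓡 n).prod 𝓘(ℝ, ℝ)) (suspensionForm (𝓡 n) α) (k + 1) p ≠ 0 := fun k hk p =>
    evenTerm_suspensionForm_ne_zero (𝓡 n) hα p (hn.trans hk)
      (oddTerm_ne_zero_of_genreAt_eq (𝓡 n) α p.1 k ((hgen p.1).trans hk))
  refine ⟨hs, fun p => genreAt_eq_finrank _ _ _ ?_, ?_, ?_⟩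
  · rw [hn']
    rcases Nat.even_or_odd' n with ⟨k, hk | hk⟩
    · exact Or.inl ⟨k, by omega, heven k hk p⟩
    · exact Or.inr ⟨k + 1, by omega, by omega, hodd k hk p⟩
  · intro h
    obtain ⟨k, hk⟩ := h.two_dvd
    exact ⟨hs, k, by rw [hn', hk], heven k hk⟩
  · rintro ⟨k, hk⟩
    refine ⟨isSmoothForm_extD _ hs, extD_extD _ hs, fun p v hv => ?_⟩
    exact eq_zero_of_wedgePow_form_ne_zero ((𝓡 n).prod 𝓘(ℝ, ℝ)) _ p (hn'.trans (by omega))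
      (hodd k hk p) v hv
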